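/- \textbf{Setting.} Let $(V,E)$ be a finite directed graph (buses $V$, lines $E$) with incidence matrix $C\in\mathbb R^{V\times E}$ (entry $1$ at the initial bus of a line, $-1$ at its terminal bus, $0$ otherwise). Let $B=\operatorname{diag}(b_j)_{j\in E}$ and $W=\operatorname{diag}(w_i)_{i\in V}$ with $w_i>0$, let $S\in\mathbb R^{K\times E}$ with $K$ a finite index set of inter-area flows, and let $p^D,\underline p^C,\overline p^C\in\mathbb R^V$, $\underline p,\overline p\in\mathbb R^E$, $\psi\in\mathbb R^K$ be constant vectors. Let $\underline K^u,\overline K^u\in\mathbb R^V$, $K^{\overline\mu},K^{\underline\mu}\in\mathbb R^E$, $\underline K^\phi,\overline K^\phi\in\mathbb R^K$ be limits. Neither connectedness of the graph nor any further relation between these parameters is needed. Consider the system for $(\eta,u,\overline\mu,\underline\mu,\phi)\in\mathbb R^V\times\mathbb R^V\times\mathbb R^E\times\mathbb R^E\times\mathbb R^K$ $$\dot\eta=CB(-C^Tu-\overline\mu+\underline\mu-S^T\phi),\qquad \chi=BC^T\eta,\qquad p^C_i=\min\{\overline p^C_i,\max\{\underline p^C_i,u_i/w_i\}\},$$ $$\dot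 u=\Gamma^u(C\chi-p^C-p^D),\quad \dot{\overline\mu}=\Gamma^{\overline\mu}(\chi-\overline p),\quad \dot{\underline\mu}=\Gamma^{\underline\mu}(\underline p-\chi),\quad \dot\phi=\Gamma^\phi(S\chi-\psi),$$ where each $\Gamma$ is the state-dependent diagonal matrix whose entry, for a scalar variable $z$ with limits $\underline k\le z\le\overline k$ and equation $\dot z=\gamma v$, is $\gamma=0$ if ($z=\overline k$ and $v\ge0$) or ($z=\underline k$ and $v\le0$), and $\gamma=1$ otherwise. The limits are $\underline K^u_i\le u_i\le\overline K^u_i$, $0\le\overline\mu_j\le K^{\overline\mu}_j$, $0\le\underline\mu_j\le K^{\underline\mu}_j$, $\underline K^\phi_k\le\phi_k\le\overline K^\phi_k$. A trajectory is a map on $[0,\infty)$ whose components are absolutely continuous on every $[0,T]$, which satisfies the differential equations for almost every $t\ge0$, and which stays within the limits for all $t\ge0$. An equilibrium is a point $(\eta^*,u^*,\overline\mu^*,\underline\mu^*,\phi^*)$ within the limits at which all right-hand sides vanish; $(p^C)^*$ is the corresponding value of $p^C$. \textbf{Lemma.} For every trajectory and every equilibrium, $$\lim_{t\to\infty}p^C_i(t)=(p^C_i)^*\qquad\text{for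 every } i\in V.$$ -/

import Mathlib

open Filter Topology MeasureTheory Matrix

noncomputable section

/-- A power network with its control parameters: buses `V`, lines `E`, inter-area flows `K`.
The lines are the edges of a directed graph. -/
structure ControlNetwork (V E K : Type*) where
  /-- initial bus of a line -/
  src : E → V
  /-- terminal bus of a line -/
  tgt : E → V
  /-- line parameters `b_j`, the diagonal of `B` -/
  b : E → ℝ
  /-- control costs `w_i`, the diagonal of the positive definite diagonal matrix `W` -/
  w : V → ℝ
  w_pos : ∀ i, 0 < w i
  /-- constant disturbances `p^D` -/
  pD : V → ℝ
  /-- lower control bounds -/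
  pCLo : V → ℝ
  /-- upper control bounds -/
  pCUp : V → ℝ
  /-- lower line bounds -/
  pLo : E → ℝ
  /-- upper line bounds -/
  pUp : E → ℝ
  /-- participation of the lines in the inter-area flows -/
  S : Matrix K E ℝ
  /-- prescribed inter-area flows -/
  ψ : K → ℝ
  /-- lower limits of `u` -/
  KuLo : V → ℝ
  /-- upper limits of `u` -/
  KuUp : V → ℝ
  /-- upper limits of the multipliers of the upper line bounds (their lower limits are `0`) -/
  KμUp : E → ℝ
  /-- upper limits of the multipliers of the lower line bounds (their lower limits are `0`) -/
  KμLo : E → ℝ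
  /-- lower limits of `φ` -/
  KφLo : K → ℝ
  /-- upper limits of `φ` -/
  KφUp : K → ℝ

/-- The variables `η, u, μ̄, μ_, φ` of the control system. -/
structure ControlState (V E K : Type*) where
  η : V → ℝ
  u : V → ℝ
  μUp : E → ℝ
  μLo : E → ℝ
  φ : K → ℝ

/-- The diagonal entry `γ` of a matrix `Γ` for a variable with value `x`, limits `lo` and `hi`,
and unconstrained rate of change `v`: it is `0` if `x` is at a limit and `v` does not point
strictly into the interior, and `1` otherwise. -/
def gate (lo hi x v : ℝ) : ℝ :=
  open Classical in if (x = hi ∧ 0 ≤ v) ∨ (x = lo ∧ v ≤ 0) then 0 else 1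

namespace ControlNetwork

variable {V E K : Type*} [Fintype V] [DecidableEq V] [Fintype E] [DecidableEq E] [Fintype K]

/-- The bus-line incidence matrix: `1` at the initial bus of a line, `-1` at its terminal bus. -/
def C (N : ControlNetwork V E K) : Matrix V E ℝ :=
  Matrix.of fun i j => (if N.src j = i then 1 else 0) - (if N.tgt j = i then 1 else 0)

/-- The diagonal matrix of line parameters. -/
def B (N : ControlNetwork V E K) : Matrix E E ℝ := Matrix.diagonal N.b

/-- `χ = B Cᵀ η`. -/
def χ (N : ControlNetwork V E K) (x : ControlState V E K) : E → ℝ := (N.B * N.Cᵀ) *ᵥ x.η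

/-- The control values: `W⁻¹ u`, clamped componentwise between the control bounds. -/
def pC (N : ControlNetwork V E K) (x : ControlState V E K) : V → ℝ :=
  fun i => min (N.pCUp i) (max (N.pCLo i) (x.u i / N.w i))

/-- The right-hand side of the equation for `η`. -/
def rateη (N : ControlNetwork V E K) (x : ControlState V E K) : V → ℝ :=
  (N.C * N.B) *ᵥ (-(N.Cᵀ *ᵥ x.u) - x.μUp + x.μLo - N.Sᵀ *ᵥ x.φ)

/-- The right-hand side `Γ^u (C χ - p^C - p^D)` of the equation for `u`. -/
def rateU (N : ControlNetwork V E K) (x : ControlState V E K) : V → ℝ := fun i =>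
  let v := (N.C *ᵥ N.χ x) i - N.pC x i - N.pD i
  gate (N.KuLo i) (N.KuUp i) (x.u i) v * v

/-- The right-hand side for the multipliers of the upper line bounds. -/
def rateμUp (N : ControlNetwork V E K) (x : ControlState V E K) : E → ℝ := fun j =>
  let v := N.χ x j - N.pUp j
  gate 0 (N.KμUp j) (x.μUp j) v * v

/-- The right-hand side for the multipliers of the lower line bounds. -/
def rateμLo (N : ControlNetwork V E K) (x : ControlState V E K) : E → ℝ := fun j =>
  let v := N.pLo j - N.χ x j
  gate 0 (N.KμLo j) (x.μLo j) v * v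

/-- The right-hand side `Γ^φ (S χ - ψ)` of the equation for `φ`. -/
def rateφ (N : ControlNetwork V E K) (x : ControlState V E K) : K → ℝ := fun k =>
  let v := (N.S *ᵥ N.χ x) k - N.ψ k
  gate (N.KφLo k) (N.KφUp k) (x.φ k) v * v

/-- The limited variables `u, μ̄, μ_, φ` lie within their limits. -/
structure WithinLimits (N : ControlNetwork V E K) (x : ControlState V E K) : Prop where
  u : ∀ i, x.u i ∈ Set.Icc (N.KuLo i) (N.KuUp i)
  μUp : ∀ j, x.μUp j ∈ Set.Icc 0 (N.KμUp j)
  μLo : ∀ j, x.μLo j ∈ Set.Icc 0 (N.KμLo j)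
  φ : ∀ k, x.φ k ∈ Set.Icc (N.KφLo k) (N.KφUp k)

/-- Equilibrium points: states within the limits at which every right-hand side vanishes. -/
structure IsEquilibrium (N : ControlNetwork V E K) (x : ControlState V E K) : Prop where
  withinLimits : N.WithinLimits x
  η : ∀ i, N.rateη x i = 0
  u : ∀ i, N.rateU x i = 0
  μUp : ∀ j, N.rateμUp x j = 0
  μLo : ∀ j, N.rateμLo x j = 0
  φ : ∀ k, N.rateφ x k = 0

/-- `f` is absolutely continuous on every `[0, T]`, and `f' = g` almost everywhere
on `[0, ∞)`. -/
def SolvesAE (f g : ℝ → ℝ) : Prop :=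
  (∀ T : ℝ, 0 ≤ T → AbsolutelyContinuousOnInterval f 0 T) ∧
    ∀ᵐ t ∂(volume.restrict (Set.Ici (0 : ℝ))), HasDerivAt f (g t) t

/-- Trajectories on `[0, ∞)` in the sense of Carathéodory (the right-hand sides are
discontinuous), staying within the limits. -/
structure IsTrajectory (N : ControlNetwork V E K) (x : ℝ → ControlState V E K) : Prop where
  withinLimits : ∀ t, 0 ≤ t → N.WithinLimits (x t)
  η : ∀ i, SolvesAE (fun t => (x t).η i) (fun t => N.rateη (x t) i)
  u : ∀ i, SolvesAE (fun t => (x t).u i) (fun t => N.rateU (x t) i)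
  μUp : ∀ j, SolvesAE (fun t => (x t).μUp j) (fun t => N.rateμUp (x t) j)
  μLo : ∀ j, SolvesAE (fun t => (x t).μLo j) (fun t => N.rateμLo (x t) j)
  φ : ∀ k, SolvesAE (fun t => (x t).φ k) (fun t => N.rateφ (x t) k)

end ControlNetwork

end

/-! The half squared distance to the equilibrium is a Lyapunov function. Its derivative splits into
interconnection terms, which cancel because the coupling of `η` with the other variables is skew
(`interconnection_eq_zero`); gate effects, which never increase it (`sub_mul_gate_le`); and the
control term, which dissipates `w_i` times the squared deviation of `pC i` (`pC_dissipation`).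

Hence `η` stays bounded, so `u` has bounded rate and `pC i` is Lipschitz in time. A Barbalat
argument (`tendsto_zero_of_dissipation`) then gives convergence; it needs no continuity of the
right-hand sides, which the gates destroy. -/

/-! ### Inequalities for gates and clamps -/

lemma gate_mem (lo hi x v : ℝ) : 0 ≤ gate lo hi x v ∧ gate lo hi x v ≤ 1 := by
  unfold gate
  split_ifs <;> norm_num

lemma abs_gate_mul_le (lo hi x v : ℝ) : |gate lo hi x v * v| ≤ |v| := by
  obtain ⟨h0, h1⟩ := gate_mem lo hi x v
  rw [abs_mul, abs_of_nonneg h0]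
  exact mul_le_of_le_one_left (abs_nonneg v) h1

/-- The gated rate decreases the distance to an equilibrium value at least as fast as the
ungated one. -/
lemma sub_mul_gate_le {lo hi x y v v' : ℝ} (hx : x ∈ Set.Icc lo hi) (hy : y ∈ Set.Icc lo hi)
    (h : gate lo hi y v' * v' = 0) :
    (x - y) * (gate lo hi x v * v) ≤ (x - y) * (v - v') := by
  obtain ⟨hx1, hx2⟩ := hx
  obtain ⟨hy1, hy2⟩ := hy
  -- A closed gate means that `x` is at a limit and `v` points outward or vanishes; `y` lies on the
  -- inner side, so the discarded product is nonnegative.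
  have h1 : (x - y) * (gate lo hi x v * v) ≤ (x - y) * v := by
    unfold gate
    split_ifs with hc
    · rcases hc with ⟨rfl, hv⟩ | ⟨rfl, hv⟩
      · simpa using mul_nonneg (sub_nonneg.2 hy2) hv
      · simpa using mul_nonneg_of_nonpos_of_nonpos (sub_nonpos.2 hy1) hv
    · simp
  -- Variational inequality at `y`: either `v' = 0`, or `y` is at a limit and `v'` points away from
  -- every admissible `x`.
  have h2 : (x - y) * v' ≤ 0 := by
    unfold gate at h
    split_ifs at h with hc
    · rcases hc with ⟨rfl, hv⟩ | ⟨rfl, hv⟩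
      · exact mul_nonpos_of_nonpos_of_nonneg (sub_nonpos.2 hx2) hv
      · exact mul_nonpos_of_nonneg_of_nonpos (sub_nonneg.2 hx1) hv
    · simp_all
  linarith

lemma abs_clamp_sub_clamp_le (lo hi a b : ℝ) :
    |min hi (max lo a) - min hi (max lo b)| ≤ |a - b| := by
  refine (abs_min_sub_min_le_max _ _ _ _).trans (max_le (by simp) ?_)
  exact (abs_max_sub_max_le_max _ _ _ _).trans (max_le (by simp) le_rfl)

/-- The clamp is monotone and 1-Lipschitz, so its increment has the sign of `a - b` and no larger
modulus. The case `lo > hi` is included. -/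
lemma sq_clamp_sub_clamp_le (lo hi a b : ℝ) :
    (min hi (max lo a) - min hi (max lo b)) ^ 2
      ≤ (a - b) * (min hi (max lo a) - min hi (max lo b)) := by
  have h := abs_clamp_sub_clamp_le lo hi a b
  rcases le_total a b with hab | hab
  · have hm : min hi (max lo a) ≤ min hi (max lo b) := by gcongr
    rw [abs_of_nonpos (sub_nonpos.2 hm), abs_of_nonpos (sub_nonpos.2 hab)] at h
    nlinarith
  · have hm : min hi (max lo b) ≤ min hi (max lo a) := by gcongr
    rw [abs_of_nonneg (sub_nonneg.2 hm), abs_of_nonneg (sub_nonneg.2 hab)] at h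
    nlinarith

lemma abs_clamp_le (lo hi a : ℝ) : |min hi (max lo a)| ≤ |lo| + |hi| := by
  rw [abs_le]
  constructor
  · exact le_min (by linarith [neg_abs_le hi, abs_nonneg lo])
      (le_max_of_le_left (by linarith [neg_abs_le lo, abs_nonneg hi]))
  · exact (min_le_left _ _).trans (by linarith [le_abs_self hi, abs_nonneg lo])

lemma abs_mulVec_le {m n : Type*} [Fintype n] (A : Matrix m n ℝ) (y : n → ℝ) {R : ℝ}
    (hy : ∀ j, |y j| ≤ R) (i : m) : |(A *ᵥ y) i| ≤ (∑ j, |A i j|) * R := by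
  rw [Finset.sum_mul]
  refine (Finset.abs_sum_le_sum_abs _ _).trans (Finset.sum_le_sum fun j _ => ?_)
  rw [abs_mul]
  exact mul_le_mul_of_nonneg_left (hy j) (abs_nonneg _)

namespace ControlNetwork

/-! ### Calculus of absolutely continuous solutions -/

namespace SolvesAE

lemma add {f₁ f₂ g₁ g₂ : ℝ → ℝ} (h₁ : SolvesAE f₁ g₁) (h₂ : SolvesAE f₂ g₂) :
    SolvesAE (fun t => f₁ t + f₂ t) (fun t => g₁ t + g₂ t) := by
  refine ⟨fun T hT => (h₁.1 T hT).add (h₂.1 T hT), ?_⟩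
  filter_upwards [h₁.2, h₂.2] with t a b using a.add b

lemma neg {f g : ℝ → ℝ} (h : SolvesAE f g) : SolvesAE (fun t => -f t) (fun t => -g t) := by
  refine ⟨fun T hT => (h.1 T hT).neg, ?_⟩
  filter_upwards [h.2] with t a using a.neg

lemma const (c : ℝ) : SolvesAE (fun _ => c) (fun _ => 0) :=
  ⟨fun T _ => ((LipschitzWith.const c).lipschitzOnWith (s := Set.uIcc 0 T)
    ).absolutelyContinuousOnInterval, Eventually.of_forall fun t => hasDerivAt_const t c⟩

lemma sum {ι : Type*} (s : Finset ι) {f g : ι → ℝ → ℝ} (h : ∀ i, SolvesAE (f i) (g i)) :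
    SolvesAE (fun t => ∑ i ∈ s, f i t) (fun t => ∑ i ∈ s, g i t) := by
  classical
  induction s using Finset.induction_on with
  | empty => simpa using const 0
  | insert a s ha ih => simpa only [Finset.sum_insert ha] using (h a).add ih

lemma half_sq_sub {f g : ℝ → ℝ} (h : SolvesAE f g) (c : ℝ) :
    SolvesAE (fun t => (f t - c) ^ 2 / 2) (fun t => (f t - c) * g t) := by
  constructor
  · intro T hT
    have h1 := (h.1 T hT).sub ((const c).1 T hT)
    refine (congrArg (AbsolutelyContinuousOnInterval · 0 T) (funext fun t => ?_)).mp
      ((h1.mul h1).const_mul (1 / 2))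
    simp only [Pi.mul_apply, Pi.sub_apply]
    ring
  · filter_upwards [h.2] with t a
    refine (((a.sub_const c).pow 2).div_const 2).congr_deriv ?_
    push_cast
    ring

/-- One-sided mean value inequality for absolutely continuous functions. -/
lemma sub_le {f g : ℝ → ℝ} (h : SolvesAE f g) {a b c : ℝ} (ha : 0 ≤ a) (hab : a ≤ b)
    (hg : ∀ t ∈ Set.Icc a b, g t ≤ c) : f b - f a ≤ c * (b - a) := by
  have hac : AbsolutelyContinuousOnInterval f a b := by
    refine (h.1 b (ha.trans hab)).mono ?_
    rw [Set.uIcc_of_le hab, Set.uIcc_of_le (ha.trans hab)]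
    exact Set.Icc_subset_Icc_left ha
  rw [← hac.integral_deriv_eq_sub]
  have hc : ∫ _ in a..b, c = c * (b - a) := by simp [mul_comm]
  rw [← hc]
  refine intervalIntegral.integral_mono_ae_restrict hab hac.intervalIntegrable_deriv
    intervalIntegrable_const ?_
  have hsub : Set.Icc a b ⊆ Set.Ici (0 : ℝ) := fun t ht => ha.trans ht.1
  filter_upwards [ae_restrict_of_ae_restrict_of_subset hsub h.2,
    ae_restrict_mem measurableSet_Icc] with t ht hmem
  rw [ht.deriv]
  exact hg t hmem

lemma abs_sub_le {f g : ℝ → ℝ} (h : SolvesAE f g) {L : ℝ} (hg : ∀ t, 0 ≤ t → |g t| ≤ L)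
    {a b : ℝ} (ha : 0 ≤ a) (hab : a ≤ b) : |f b - f a| ≤ L * (b - a) := by
  refine abs_le.2 ⟨?_, ?_⟩
  · have := h.neg.sub_le ha hab (c := L)
      fun t ht => by linarith [(abs_le.1 (hg t (ha.trans ht.1))).1]
    linarith
  · exact h.sub_le ha hab fun t ht => (abs_le.1 (hg t (ha.trans ht.1))).2

/-- A Barbalat-type lemma: a Lipschitz quantity whose square is dissipated by a nonnegative
storage function tends to zero. -/
lemma tendsto_zero_of_dissipation {F G q : ℝ → ℝ} (h : SolvesAE F G) {c L : ℝ} (hc : 0 < c)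
    (hF : ∀ t, 0 ≤ F t) (hG : ∀ t, 0 ≤ t → G t ≤ -(c * q t ^ 2))
    (hq : ∀ a b, 0 ≤ a → a ≤ b → |q b - q a| ≤ L * (b - a)) :
    Tendsto q atTop (𝓝 0) := by
  have hanti : ∀ a b, 0 ≤ a → a ≤ b → F b ≤ F a := fun a b ha hab => by
    have := h.sub_le ha hab (c := 0) fun t ht =>
      (hG t (ha.trans ht.1)).trans (neg_nonpos.2 (by positivity))
    linarith
  have hlim : ∃ l, Tendsto F atTop (𝓝 l) := by
    -- Freezing `F` at its initial value for negative times makes it antitone on the whole line.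
    have hanti' : Antitone fun t => F (max t 0) := fun a b hab =>
      hanti _ _ (le_max_right _ _) (max_le_max_right _ hab)
    refine ⟨_, (tendsto_atTop_ciInf hanti' ⟨0, ?_⟩).congr' ?_⟩
    · rintro _ ⟨t, rfl⟩
      exact hF _
    · filter_upwards [eventually_ge_atTop 0] with t ht
      rw [max_eq_left ht]
  obtain ⟨l, hl⟩ := hlim
  rw [Metric.tendsto_atTop']
  intro ε hε
  -- Within time `δ` the quantity `q` moves by at most `ε / 2`. If `|q t| ≥ ε`, then `F` drops by at
  -- least `c * (ε / 2) ^ 2 * δ` on `[t, t + δ]`, which is impossible for late `t` since `F`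
  -- converges. The summand `1` covers `L = 0`.
  set δ := ε / (2 * (|L| + 1)) with hδ_def
  have hL : 0 < |L| + 1 := by positivity
  have hδ : 0 < δ := by positivity
  have hLδ : (|L| + 1) * δ = ε / 2 := by rw [hδ_def]; field_simp
  have hdiff : Tendsto (fun t => F t - F (t + δ)) atTop (𝓝 0) := by
    simpa using hl.sub (hl.comp (tendsto_atTop_add_const_right _ δ tendsto_id))
  have hpos : 0 < c * (ε / 2) ^ 2 * δ := by positivity
  obtain ⟨T, hT⟩ := eventually_atTop.1
    ((hdiff.eventually (gt_mem_nhds hpos)).and (eventually_ge_atTop 0))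
  refine ⟨T, fun t ht => ?_⟩
  obtain ⟨hlt, ht0⟩ := hT t ht.le
  rw [Real.dist_eq, sub_zero]
  by_contra! hge
  have := h.sub_le ht0 (le_add_of_nonneg_right hδ.le) (c := -(c * (ε / 2) ^ 2)) fun s hs => by
    refine (hG s (ht0.trans hs.1)).trans (neg_le_neg ?_)
    have h1 := hq t s ht0 hs.1
    have h2 : L * (s - t) ≤ (|L| + 1) * δ :=
      mul_le_mul (by linarith [le_abs_self L]) (by linarith [hs.2]) (by linarith [hs.1]) hL.le
    have h3 : ε / 2 ≤ |q s| := by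
      have := abs_sub_abs_le_abs_sub (q t) (q s)
      rw [abs_sub_comm] at this
      linarith
    rw [← sq_abs (q s)]
    gcongr
  rw [add_sub_cancel_left] at this
  linarith

end SolvesAE

/-! ### Storage function and its dissipation -/

variable {V E K : Type*}

lemma pC_dissipation (N : ControlNetwork V E K) (x y : ControlState V E K) (i : V) :
    N.w i * (N.pC x i - N.pC y i) ^ 2 ≤ (x.u i - y.u i) * (N.pC x i - N.pC y i) := by
  have hw := N.w_pos i
  have h := mul_le_mul_of_nonneg_left
    (sq_clamp_sub_clamp_le (N.pCLo i) (N.pCUp i) (x.u i / N.w i) (y.u i / N.w i)) hw.le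
  have e : N.w i * (x.u i / N.w i - y.u i / N.w i) = x.u i - y.u i := by field_simp
  rwa [← mul_assoc, e] at h

lemma abs_pC_sub_le (N : ControlNetwork V E K) (x y : ControlState V E K) (i : V) :
    |N.pC x i - N.pC y i| ≤ (N.w i)⁻¹ * |x.u i - y.u i| := by
  refine (abs_clamp_sub_clamp_le _ _ _ _).trans (le_of_eq ?_)
  rw [← sub_div, abs_div, abs_of_pos (N.w_pos i), div_eq_inv_mul]

variable [Fintype V] [Fintype E] [Fintype K]

/-- The squared distance of two states, halved. -/
noncomputable def storage (y x : ControlState V E K) : ℝ :=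
  ((((∑ i, (x.η i - y.η i) ^ 2 / 2) + ∑ i, (x.u i - y.u i) ^ 2 / 2)
    + ∑ j, (x.μUp j - y.μUp j) ^ 2 / 2) + ∑ j, (x.μLo j - y.μLo j) ^ 2 / 2)
    + ∑ k, (x.φ k - y.φ k) ^ 2 / 2

lemma storage_nonneg (y x : ControlState V E K) : 0 ≤ storage y x := by
  unfold storage
  positivity

lemma abs_η_sub_le (y x : ControlState V E K) (i : V) :
    |x.η i - y.η i| ≤ √(2 * storage y x) := by
  apply Real.abs_le_sqrt
  have h1 : (x.η i - y.η i) ^ 2 / 2 ≤ ∑ i, (x.η i - y.η i) ^ 2 / 2 :=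
    Finset.single_le_sum (f := fun i => (x.η i - y.η i) ^ 2 / 2)
      (fun i _ => by positivity) (Finset.mem_univ i)
  have h2 : 0 ≤ ∑ i, (x.u i - y.u i) ^ 2 / 2 := by positivity
  have h3 : 0 ≤ ∑ j, (x.μUp j - y.μUp j) ^ 2 / 2 := by positivity
  have h4 : 0 ≤ ∑ j, (x.μLo j - y.μLo j) ^ 2 / 2 := by positivity
  have h5 : 0 ≤ ∑ k, (x.φ k - y.φ k) ^ 2 / 2 := by positivity
  unfold storage
  linarith

variable [DecidableEq V] [DecidableEq E]

/-- The rate of change of `storage y` along the control system. -/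
noncomputable def storageRate (N : ControlNetwork V E K) (y x : ControlState V E K) : ℝ :=
  ((((∑ i, (x.η i - y.η i) * N.rateη x i) + ∑ i, (x.u i - y.u i) * N.rateU x i)
    + ∑ j, (x.μUp j - y.μUp j) * N.rateμUp x j) + ∑ j, (x.μLo j - y.μLo j) * N.rateμLo x j)
    + ∑ k, (x.φ k - y.φ k) * N.rateφ x k

lemma IsTrajectory.storage {N : ControlNetwork V E K} {x : ℝ → ControlState V E K}
    (hx : N.IsTrajectory x) (y : ControlState V E K) :
    SolvesAE (fun t => storage y (x t)) (fun t => N.storageRate y (x t)) :=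
  -- The nesting follows the bracketing in `storage` and `storageRate`, so the terms match
  -- definitionally.
  ((((SolvesAE.sum _ fun i => (hx.η i).half_sq_sub _).add
    (SolvesAE.sum _ fun i => (hx.u i).half_sq_sub _)).add
    (SolvesAE.sum _ fun j => (hx.μUp j).half_sq_sub _)).add
    (SolvesAE.sum _ fun j => (hx.μLo j).half_sq_sub _)).add
    (SolvesAE.sum _ fun k => (hx.φ k).half_sq_sub _)

/-- The interconnection terms of the control system cancel in the storage rate. -/
lemma interconnection_eq_zero (N : ControlNetwork V E K) {x y : ControlState V E K}
    (hy : ∀ i, N.rateη y i = 0) :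
    (x.η - y.η) ⬝ᵥ N.rateη x + (x.u - y.u) ⬝ᵥ (N.C *ᵥ (N.χ x - N.χ y))
      + (x.μUp - y.μUp) ⬝ᵥ (N.χ x - N.χ y) - (x.μLo - y.μLo) ⬝ᵥ (N.χ x - N.χ y)
      + (x.φ - y.φ) ⬝ᵥ (N.S *ᵥ (N.χ x - N.χ y)) = 0 := by
  have hy0 : N.rateη y = 0 := funext hy
  have hχ : N.χ x - N.χ y = (x.η - y.η) ᵥ* (N.C * N.B) := by
    -- `B` is diagonal, hence symmetric: the map from `η` to `χ` is the transpose of the one driving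
    -- `η`. This makes the coupling skew.
    have : N.B * N.Cᵀ = (N.C * N.B)ᵀ := by simp [B]
    rw [χ, χ, this, ← Matrix.mulVec_sub, Matrix.mulVec_transpose]
  have hη : (x.η - y.η) ⬝ᵥ N.rateη x = (N.χ x - N.χ y) ⬝ᵥ
      (-((x.u - y.u) ᵥ* N.C) - (x.μUp - y.μUp) + (x.μLo - y.μLo) - (x.φ - y.φ) ᵥ* N.S) := by
    -- Subtracting the vanishing rate at `y` leaves an expression linear in the deviations.
    rw [← sub_zero (N.rateη x), ← hy0, hχ, ← Matrix.dotProduct_mulVec, rateη, rateη,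
      ← Matrix.mulVec_sub]
    simp only [Matrix.mulVec_transpose, Matrix.sub_vecMul]
    congr 2
    abel
  rw [hη, Matrix.dotProduct_mulVec, Matrix.dotProduct_mulVec]
  generalize N.χ x - N.χ y = d
  rw [dotProduct_comm d]
  simp only [sub_dotProduct, add_dotProduct, neg_dotProduct]
  ring

/-- The storage function with respect to an equilibrium is strictly dissipated by deviations of
the control values. -/
lemma storageRate_le (N : ControlNetwork V E K) {x y : ControlState V E K}
    (hx : N.WithinLimits x) (hy : N.IsEquilibrium y) (i : V) :
    N.storageRate y x ≤ -(N.w i * (N.pC x i - N.pC y i) ^ 2) := by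
  have hu : ∑ i, (x.u i - y.u i) * N.rateU x i
      ≤ (x.u - y.u) ⬝ᵥ (N.C *ᵥ (N.χ x - N.χ y)) - ∑ i, N.w i * (N.pC x i - N.pC y i) ^ 2 := by
    rw [dotProduct, ← Finset.sum_sub_distrib]
    refine Finset.sum_le_sum fun i _ => ?_
    have h1 := sub_mul_gate_le (v := (N.C *ᵥ N.χ x) i - N.pC x i - N.pD i)
      (hx.u i) (hy.withinLimits.u i) (hy.u i)
    have h2 := N.pC_dissipation x y i
    simp only [rateU, Matrix.mulVec_sub, Pi.sub_apply]
    linarith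
  have hUp : ∑ j, (x.μUp j - y.μUp j) * N.rateμUp x j
      ≤ (x.μUp - y.μUp) ⬝ᵥ (N.χ x - N.χ y) := by
    refine Finset.sum_le_sum fun j _ => ?_
    have h1 := sub_mul_gate_le (v := N.χ x j - N.pUp j)
      (hx.μUp j) (hy.withinLimits.μUp j) (hy.μUp j)
    simp only [rateμUp, Pi.sub_apply]
    linarith
  have hLo : ∑ j, (x.μLo j - y.μLo j) * N.rateμLo x j
      ≤ -((x.μLo - y.μLo) ⬝ᵥ (N.χ x - N.χ y)) := by
    rw [← dotProduct_neg]
    refine Finset.sum_le_sum fun j _ => ?_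
    have h1 := sub_mul_gate_le (v := N.pLo j - N.χ x j)
      (hx.μLo j) (hy.withinLimits.μLo j) (hy.μLo j)
    simp only [rateμLo, Pi.sub_apply, Pi.neg_apply]
    linarith
  have hφ : ∑ k, (x.φ k - y.φ k) * N.rateφ x k
      ≤ (x.φ - y.φ) ⬝ᵥ (N.S *ᵥ (N.χ x - N.χ y)) := by
    refine Finset.sum_le_sum fun k _ => ?_
    have h1 := sub_mul_gate_le (v := (N.S *ᵥ N.χ x) k - N.ψ k)
      (hx.φ k) (hy.withinLimits.φ k) (hy.φ k)
    simp only [rateφ, Matrix.mulVec_sub, Pi.sub_apply]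
    linarith
  have hη : ∑ i, (x.η i - y.η i) * N.rateη x i = (x.η - y.η) ⬝ᵥ N.rateη x := rfl
  -- All buses dissipate; only the contribution of bus `i` is kept.
  have hi : N.w i * (N.pC x i - N.pC y i) ^ 2 ≤ ∑ i, N.w i * (N.pC x i - N.pC y i) ^ 2 :=
    Finset.single_le_sum (f := fun i => N.w i * (N.pC x i - N.pC y i) ^ 2)
      (fun i _ => mul_nonneg (N.w_pos i).le (sq_nonneg _)) (Finset.mem_univ i)
  have h0 := N.interconnection_eq_zero (x := x) hy.η
  unfold storageRate
  linarith

/-- This supplies the bound on `η`, the only variable without prescribed limits. -/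
lemma storage_le_zero_time {N : ControlNetwork V E K} {x : ℝ → ControlState V E K}
    (hx : N.IsTrajectory x) {y : ControlState V E K} (hy : N.IsEquilibrium y) (i : V)
    {t : ℝ} (ht : 0 ≤ t) : storage y (x t) ≤ storage y (x 0) := by
  have := (hx.storage y).sub_le le_rfl ht (c := 0) fun s hs =>
    (N.storageRate_le (hx.withinLimits s hs.1) hy i).trans
      (neg_nonpos.2 (mul_nonneg (N.w_pos i).le (sq_nonneg _)))
  linarith

/-- Along a trajectory the rate of change of `u` is bounded. -/
lemma exists_rateU_bound {N : ControlNetwork V E K} {x : ℝ → ControlState V E K}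
    (hx : N.IsTrajectory x) {y : ControlState V E K} (hy : N.IsEquilibrium y) (i : V) :
    ∃ L, ∀ t, 0 ≤ t → |N.rateU (x t) i| ≤ L := by
  -- `R` bounds every `|η k|` along the trajectory. This suffices, since `χ` is linear in `η` and
  -- `pC` is bounded by its clamp.
  set R := √(2 * storage y (x 0)) + ∑ k, |y.η k|
  refine ⟨(∑ k, |(N.C * (N.B * N.Cᵀ)) i k|) * R + (|N.pCLo i| + |N.pCUp i|) + |N.pD i|,
    fun t ht => (abs_gate_mul_le _ _ _ _).trans ?_⟩
  have hη : ∀ k, |(x t).η k| ≤ R := fun k => by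
    have h1 := abs_η_sub_le y (x t) k
    have h2 : √(2 * storage y (x t)) ≤ √(2 * storage y (x 0)) :=
      Real.sqrt_le_sqrt (by linarith [storage_le_zero_time hx hy i ht])
    have h3 : |y.η k| ≤ ∑ k, |y.η k| :=
      Finset.single_le_sum (f := fun k => |y.η k|) (fun _ _ => abs_nonneg _) (Finset.mem_univ k)
    have h4 := abs_sub_abs_le_abs_sub ((x t).η k) (y.η k)
    linarith
  have h1 := abs_mulVec_le (N.C * (N.B * N.Cᵀ)) (x t).η hη i
  rw [← Matrix.mulVec_mulVec] at h1
  have h2 : |N.pC (x t) i| ≤ |N.pCLo i| + |N.pCUp i| := abs_clamp_le _ _ _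
  refine (abs_sub _ _).trans (add_le_add ((abs_sub _ _).trans (add_le_add h1 h2)) le_rfl)

end ControlNetwork

theorem mainTheorem2 {V E K : Type*} [Fintype V] [DecidableEq V] [Fintype E] [DecidableEq E]
    [Fintype K] (N : ControlNetwork V E K)
    (x : ℝ → ControlState V E K) (hx : N.IsTrajectory x)
    (xEq : ControlState V E K) (hEq : N.IsEquilibrium xEq) (i : V) :
    Tendsto (fun t : ℝ => N.pC (x t) i) atTop (𝓝 (N.pC xEq i)) := by
  obtain ⟨L, hL⟩ := ControlNetwork.exists_rateU_bound hx hEq i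
  rw [← tendsto_sub_nhds_zero_iff]
  -- The Lipschitz constant in time combines the factor `1 / w_i` of the control law with the bound
  -- `L` on the rate of `u i`.
  refine (hx.storage xEq).tendsto_zero_of_dissipation (N.w_pos i) (L := (N.w i)⁻¹ * L)
    (fun t => ControlNetwork.storage_nonneg _ _)
    (fun t ht => N.storageRate_le (hx.withinLimits t ht) hEq i) fun a b ha hab => ?_
  rw [sub_sub_sub_cancel_right, mul_assoc]
  exact (N.abs_pC_sub_le _ _ i).trans (mul_le_mul_of_nonneg_left
    ((hx.u i).abs_sub_le hL ha hab) (inv_nonneg.2 (N.w_pos i).le))
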